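/- **Setting.** Let $p,q\ge 1$ and let $\mathrm d\mu=(\mathrm d\mu_{b,a})$ be a $q\times p$ matrix of (complex) measures on $\mathbb R$ with absolutely convergent moments of every order. For $k\in\mathbb N$ put $X_{[k]}(x)=(I_k,xI_k,x^2I_k,\dots)^\top$. Assume that the moment matrix $\mathscr M=\int X_{[q]}\,\mathrm d\mu\,X_{[p]}^\top$ has a Gauss–Borel factorization $\mathscr M=S^{-1}H\bar S^{-\top}$, with $S,\bar S$ lower unitriangular and $H$ invertible diagonal, and define the row vectors $B_n=(B_n^{(1)},\dots,B_n^{(q)})$ as the rows of $B=SX_{[q]}$ and the column vectors $A_n=(A_n^{(1)},\dots,A_n^{(p)})^\top$ as the columns of $A=X_{[p]}^\top\bar S^\top H^{-1}$ ($n\ge 0$). Let $R(x)=\sum_{k=0}^{N^R}R_kx^k$ be a $p\times p$ and $L(x)=\sum_{k=0}^{N^L}L_kx^k$ a $q\times q$ complex matrix polynomial, and let $0\le r\le p-1$, $0\le l\le q-1$, such that $$R_{N^R}=\begin{bmatrix}0_{(p-r)\times r}&I_{p-r}\\0_{r\times r}&0_{r\times(p-r)}\end{bmatrix},\quad R_{N^R-1}=\begin{bmatrix}*&*\\I_r&*\end{bmatrix},\qquad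 L_{N^L}=\begin{bmatrix}0_{l\times(q-l)}&0_{l\times l}\\I_{q-l}&0_{(q-l)\times l}\end{bmatrix},\quad L_{N^L-1}=\begin{bmatrix}*&I_l\\ *&*\end{bmatrix}$$ (if $N^R=0$ then $r=0$ and $R=I_p$; if $N^L=0$ then $l=0$ and $L=I_q$). Then $\det R$ and $\det L$ have degrees $M^R=N^Rp-r$ and $M^L=N^Lq-l$. Assume that all zeros $\rho_1,\dots,\rho_{M^R}$ of $\det R$ and all zeros $\lambda_1,\dots,\lambda_{M^L}$ of $\det L$ in $\mathbb C$ are simple. Let $\vec r_i$ and $\overleftarrow r_i$ be nonzero right and left null vectors of $R(\rho_i)$, let $\vec l_j$ be a nonzero right null vector of $L(\lambda_j)$, and let $\xi_i$ be arbitrary functions on $\mathbb C$ with values in the column vectors $\mathbb C^q$. The Uvarov perturbation, which satisfies $\mathrm d\tilde\mu\,R=L\,\mathrm d\mu$, is $$\mathrm d\tilde\mu=L\,\mathrm d\mu\,R^{-1}+\sum_{i=1}^{M^R}L(x)\,\xi_i(x)\,\overleftarrow r_i\,\delta(x-\rho_i).$$ Assume that $L\,\mathrm d\mu\,R^{-1}$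 is well defined as a matrix of measures with finite moments ($R$ is invertible $\mu$-almost everywhere, and the moments converge absolutely), that the integrals $\int\mathrm d\mu(x)\,\vec r_i/(\rho_i-x)$ converge absolutely (both conditions hold automatically if no $\rho_i$ lies in the support of $\mu$), and that the moment matrix of $\tilde\mu$ also has a Gauss–Borel factorization. Let $\tilde B_n$, $\tilde A_n$ be the polynomials defined from $\tilde\mu$ in the same way. **Notation.** Put $D_n(z)=\int B_n(x)\frac{\mathrm d\mu(x)}{z-x}$, where $D_n(\rho_i)\vec r_i$ is read as $\int B_n(x)\frac{\mathrm d\mu(x)\,\vec r_i}{\rho_i-x}$. For $m\ge-1$ put $K^{[m]}(x,y)=\sum_{k=0}^{m}A_k(x)B_k(y)$ and $K_D^{[m]}(x,y)=\sum_{k=0}^{m}A_k(x)D_k(y)$ (both zero for $m=-1$), and $$\mathbb B_n^{(j)}=B_n(\lambda_j)\vec l_j,\qquad \mathbb D_n^{(i)}=D_n(\rho_i)\vec r_i,\qquad \mathbb W_n^{(i)}=B_n(\rho_i)\,\xi_i(\rho_i)\,\overleftarrow r_iR'(\rho_i)\vec r_i,$$ $$\mathbb K^{[m],(j)}(x)=K^{[m]}(x,\lambda_j)\vec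 l_j,\qquad \mathbb K_D^{[m],(i)}(x)=K_D^{[m]}(x,\rho_i)\vec r_i-K^{[m]}(x,\rho_i)\,\xi_i(\rho_i)\,\overleftarrow r_iR'(\rho_i)\vec r_i .$$ Let $v_k=\big(\mathbb B_k^{(1)},\dots,\mathbb B_k^{(M^L)},\ \mathbb D_k^{(1)}-\mathbb W_k^{(1)},\dots,\mathbb D_k^{(M^R)}-\mathbb W_k^{(M^R)}\big)$, a row of length $M^L+M^R$. For $n\ge M^R$ let $\tau_n$ be the determinant with rows $v_{n-M^R},\dots,v_{n+M^L-1}$. **Theorem.** Let $n\ge M^R$ with $\tau_n\ne 0$. 1. If $n\ge1$ and $M^L+M^R\ge1$, then for all $a\in\{1,\dots,p\}$ and all $x\in\mathbb C\setminus\{\rho_1,\dots,\rho_{M^R}\}$, $$\tilde A_{n-1}^{(a)}(x)=-\frac1{\tau_n}\sum_{\tilde a=1}^pR_{a,\tilde a}(x)\begin{vmatrix}v_{n-M^R}\\ \vdots\\ v_{n+M^L-2}\\ \kappa_{\tilde a}(x)\end{vmatrix},$$ where $\kappa_{\tilde a}(x)$ is the row with entries $\mathbb K_{\tilde a}^{[n-1-M^R],(j)}(x)$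 for $j=1,\dots,M^L$, followed by $\mathbb K_{D,\tilde a}^{[n-1-M^R],(i)}(x)+\dfrac{\vec r_{i,\tilde a}}{x-\rho_i}$ for $i=1,\dots,M^R$. 2. For all $b\in\{1,\dots,q\}$ and all $x\in\mathbb C$ with $\det L(x)\neq0$, $$\tilde B_n^{(b)}(x)=\frac1{\tau_n}\sum_{\tilde b=1}^q\begin{vmatrix}v_{n-M^R}&B_{n-M^R}^{(\tilde b)}(x)\\ \vdots&\vdots\\ v_{n+M^L}&B_{n+M^L}^{(\tilde b)}(x)\end{vmatrix}\,\big(L(x)^{-1}\big)_{\tilde b,b}.$$ -/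

import Mathlib

open Polynomial MeasureTheory

noncomputable section

namespace MixedMOP

/-! ### Matrices of measures -/

/-- A `q × p` matrix of (complex) measures on the real line. Positive and signed measures with
finite moments are included, since they are finite. -/
abbrev MatrixMeasure (q p : ℕ) := Matrix (Fin q) (Fin p) (ComplexMeasure ℝ)

/-- A finite positive measure dominating all the entries of `μ`, namely the sum of the total
variations of the real and imaginary parts of the entries. -/
def base {q p : ℕ} (μ : MatrixMeasure q p) : Measure ℝ :=
  ∑ b, ∑ a, ((ComplexMeasure.re (μ b a)).totalVariation
    + (ComplexMeasure.im (μ b a)).totalVariation)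

/-- The matrix `w` of Radon–Nikodym derivatives of the entries of `μ`, so that `dμ = w d(base μ)`
(see `withDensity_density`). -/
def density {q p : ℕ} (μ : MatrixMeasure q p) (x : ℝ) : Matrix (Fin q) (Fin p) ℂ :=
  Matrix.of fun b a => (μ b a).rnDeriv (base μ) x

theorem isFiniteMeasure_base {q p : ℕ} (μ : MatrixMeasure q p) : IsFiniteMeasure (base μ) := by
  unfold base; infer_instance

/-- The relation `dμ = w d(base μ)`. -/
theorem withDensity_density {q p : ℕ} (μ : MatrixMeasure q p) (b : Fin q) (a : Fin p) :
    (base μ).withDensityᵥ (fun x => density μ x b a) = μ b a := by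
  have := isFiniteMeasure_base μ
  have hle : (ComplexMeasure.re (μ b a)).totalVariation
      + (ComplexMeasure.im (μ b a)).totalVariation ≤ base μ := by
    unfold base
    refine le_trans ?_ (Finset.single_le_sum (f := fun b => ∑ a,
      ((ComplexMeasure.re (μ b a)).totalVariation + (ComplexMeasure.im (μ b a)).totalVariation))
      (fun _ _ => Measure.zero_le _) (Finset.mem_univ b))
    exact Finset.single_le_sum (f := fun a =>
      ((ComplexMeasure.re (μ b a)).totalVariation + (ComplexMeasure.im (μ b a)).totalVariation))
      (fun _ _ => Measure.zero_le _) (Finset.mem_univ a)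
  have key : ∀ s : SignedMeasure ℝ, s.totalVariation ≤ base μ →
      (base μ).withDensityᵥ (s.rnDeriv (base μ)) = s := by
    intro s hs
    refine SignedMeasure.withDensityᵥ_rnDeriv_eq s _ (VectorMeasure.AbsolutelyContinuous.mk ?_)
    intro t ht h0
    rw [Measure.toENNRealVectorMeasure_apply_measurable ht] at h0
    exact SignedMeasure.null_of_totalVariation_zero s
      (le_antisymm ((hs t).trans h0.le) bot_le)
  have hre := key _ ((le_add_of_nonneg_right (Measure.zero_le _)).trans hle)
  have him := key _ ((le_add_of_nonneg_left (Measure.zero_le _)).trans hle)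
  have hint := ComplexMeasure.integrable_rnDeriv (μ b a) (base μ)
  ext t ht : 1
  change (base μ).withDensityᵥ ((μ b a).rnDeriv (base μ)) t = μ b a t
  have e1 : (μ b a t).re = (base μ).withDensityᵥ
      ((ComplexMeasure.re (μ b a)).rnDeriv (base μ)) t := by rw [hre]; rfl
  have e2 : (μ b a t).im = (base μ).withDensityᵥ
      ((ComplexMeasure.im (μ b a)).rnDeriv (base μ)) t := by rw [him]; rfl
  rw [withDensityᵥ_apply (SignedMeasure.integrable_rnDeriv _ _) ht] at e1 e2
  rw [withDensityᵥ_apply hint ht]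
  apply Complex.ext
  · rw [e1, ← RCLike.re_eq_complex_re, ← integral_re hint.integrableOn]; rfl
  · rw [e2, ← RCLike.im_eq_complex_im, ← integral_im hint.integrableOn]; rfl

/-- All moments of all entries of `μ` converge absolutely. -/
def HasMoments {q p : ℕ} (μ : MatrixMeasure q p) : Prop :=
  ∀ (k : ℕ) (b : Fin q) (a : Fin p),
    Integrable (fun x : ℝ => (x : ℂ) ^ k * density μ x b a) (base μ)

/-! ### Polynomial vectors, monomials and moment matrices -/

/-- The value at `x` of a vector of polynomials. -/
def evalVec {k : ℕ} (f : Fin k → ℂ[X]) (x : ℂ) : Fin k → ℂ := fun i => (f i).eval x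

/-- The value at `x` of a matrix polynomial. -/
def evalMat {k : ℕ} (P : Matrix (Fin k) (Fin k) ℂ[X]) (x : ℂ) : Matrix (Fin k) (Fin k) ℂ :=
  Matrix.of fun i j => (P i j).eval x

/-- The value at `x` of the derivative of a matrix polynomial. -/
def evalDeriv {k : ℕ} (P : Matrix (Fin k) (Fin k) ℂ[X]) (x : ℂ) : Matrix (Fin k) (Fin k) ℂ :=
  Matrix.of fun i j => (derivative (P i j)).eval x

/-- Row `n` of the semi-infinite matrix of monomials `X_{[k]}(x) = (I_k, x I_k, x² I_k, …)ᵀ`. -/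
def monomialRow (k n : ℕ) : Fin k → ℂ[X] :=
  fun b => if n % k = b then X ^ (n / k) else 0

/-- The bilinear functional `(f, g) ↦ ∫ f(x) dμ(x) g(x)`, for a row vector `f` and a column vector
`g` of polynomials. -/
def pairing {q p : ℕ} (μ : MatrixMeasure q p) (f : Fin q → ℂ[X]) (g : Fin p → ℂ[X]) : ℂ :=
  ∫ x : ℝ, evalVec f x ⬝ᵥ Matrix.mulVec (density μ x) (evalVec g x) ∂(base μ)

/-- The moment matrix `∫ X_{[q]}(x) dμ(x) X_{[p]}(x)ᵀ` of the matrix of measures (or matrix of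
linear functionals) whose pairing `(f, g) ↦ ∫ f dμ g` is `I`. -/
def momentMatrix {q p : ℕ} (I : (Fin q → ℂ[X]) → (Fin p → ℂ[X]) → ℂ) : Matrix ℕ ℕ ℂ :=
  Matrix.of fun n m => I (monomialRow q n) (monomialRow p m)

/-! ### Gauss–Borel factorization and multiple orthogonal polynomials of mixed type -/

/-- The leading principal `N × N` submatrix of a semi-infinite matrix. -/
def trunc (N : ℕ) (M : Matrix ℕ ℕ ℂ) : Matrix (Fin N) (Fin N) ℂ :=
  M.submatrix Fin.val Fin.val

/-- Lower unitriangular semi-infinite matrices. -/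
def IsLowerUnitriangular (S : Matrix ℕ ℕ ℂ) : Prop :=
  (∀ i, S i i = 1) ∧ ∀ i j, i < j → S i j = 0

/-- The Gauss–Borel factorization `M = S⁻¹ H S̄⁻ᵀ`, with `S`, `S̄` lower unitriangular and `H`
an invertible diagonal matrix. As `S` and `S̄` are lower triangular, products and inverses commute
with the truncation to leading principal submatrices, and the identity is stated on those. -/
structure IsGaussBorel (M S : Matrix ℕ ℕ ℂ) (H : ℕ → ℂ) (Sbar : Matrix ℕ ℕ ℂ) : Prop where
  lower : IsLowerUnitriangular S
  lower_bar : IsLowerUnitriangular Sbar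
  diag_ne_zero : ∀ n, H n ≠ 0
  factor : ∀ N : ℕ, trunc N M =
    (trunc N S)⁻¹ * Matrix.diagonal (fun i : Fin N => H i) * ((trunc N Sbar)⁻¹).transpose

/-- Row `n` of `B(x) = S X_{[q]}(x)`: the type II polynomials `B_n^{(1)}, …, B_n^{(q)}`. -/
def polyB (q : ℕ) (S : Matrix ℕ ℕ ℂ) (n : ℕ) : Fin q → ℂ[X] :=
  fun b => ∑ m ∈ Finset.range (n + 1), C (S n m) * monomialRow q m b

/-- Column `n` of `A(x) = X_{[p]}(x)ᵀ S̄ᵀ H⁻¹`: the type I polynomials `A_n^{(1)}, …, A_n^{(p)}`. -/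
def polyA (p : ℕ) (H : ℕ → ℂ) (Sbar : Matrix ℕ ℕ ℂ) (n : ℕ) : Fin p → ℂ[X] :=
  fun a => ∑ m ∈ Finset.range (n + 1), C (Sbar n m * (H n)⁻¹) * monomialRow p m a

/-! ### Cauchy transforms and Christoffel–Darboux kernels -/

/-- `D_n(z) v = (∫ B_n(x) dμ(x) / (z - x)) v`, the Cauchy transform of `B_n` applied to the constant
column vector `v`. The vector is kept under the integral sign, so that only the combination of
entries that occurs has to converge when `z` lies on the support. -/
def cauchyD {q p : ℕ} (μ : MatrixMeasure q p) (B : ℕ → Fin q → ℂ[X]) (n : ℕ) (z : ℂ)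
    (v : Fin p → ℂ) : ℂ :=
  ∫ x : ℝ, (evalVec (B n) x ⬝ᵥ Matrix.mulVec (density μ x) v) / (z - x) ∂(base μ)

/-- The kernel `K^{[N-1]}(x, y) = ∑_{i < N} A_i(x) B_i(y)`, a `p × q` matrix (zero for `N = 0`). -/
def kernelK {q p : ℕ} (A : ℕ → Fin p → ℂ[X]) (B : ℕ → Fin q → ℂ[X]) (N : ℕ) (x y : ℂ) :
    Matrix (Fin p) (Fin q) ℂ :=
  Matrix.of fun a b => ∑ i ∈ Finset.range N, (A i a).eval x * (B i b).eval y

/-- The mixed kernel `K_D^{[N-1]}(x, y) = ∑_{i < N} A_i(x) D_i(y)`, applied to a column vector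
`v`. -/
def kernelKD {q p : ℕ} (μ : MatrixMeasure q p) (A : ℕ → Fin p → ℂ[X]) (B : ℕ → Fin q → ℂ[X])
    (N : ℕ) (x y : ℂ) (v : Fin p → ℂ) : Fin p → ℂ :=
  fun a => ∑ i ∈ Finset.range N, (A i a).eval x * cauchyD μ B i y v

/-! ### Uvarov perturbations with simple eigenvalues -/

/-- The number `N k - s` of eigenvalues of a `k × k` matrix polynomial whose determinant has
degree `N k - s` and simple zeros. -/
abbrev numEig (N k s : ℕ) : ℕ := N * k - s

/-- The data of an Uvarov perturbation with simple eigenvalues: the matrix polynomials `L` and `R`,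
their eigenvalues and eigenvectors, and the vector functions `ξ_i` of the discrete masses.
The normalizations of the leading and subleading coefficients give `det R` the degree
`NR * p - r` and `det L` the degree `NL * q - l`, so that the existence of as many distinct zeros
means that all zeros are simple. If `NR = 0`, the normalization forces `r = 0` and `R = 1`, and
likewise for `L`. -/
structure UvarovData (q p NL l NR r : ℕ) where
  /-- the left perturbation polynomial -/
  L : Matrix (Fin q) (Fin q) ℂ[X]
  /-- the right perturbation polynomial -/
  R : Matrix (Fin p) (Fin p) ℂ[X]
  l_lt : l < q
  r_lt : r < p
  degree_L : ∀ i j, (L i j).natDegree ≤ NL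
  degree_R : ∀ i j, (R i j).natDegree ≤ NR
  /-- the leading coefficient of `R` is `[[0, I_{p-r}], [0, 0]]` -/
  lead_R : ∀ i j : Fin p, (R i j).coeff NR = if (j : ℕ) = i + r then 1 else 0
  /-- the lower left `r × r` block of the subleading coefficient of `R` is `I_r` -/
  sublead_R : ∀ i j : Fin p, p - r ≤ (i : ℕ) → (j : ℕ) < r →
    (R i j).coeff (NR - 1) = if (i : ℕ) = j + (p - r) then 1 else 0
  /-- the leading coefficient of `L` is `[[0, 0], [I_{q-l}, 0]]` -/
  lead_L : ∀ i j : Fin q, (L i j).coeff NL = if (i : ℕ) = j + l then 1 else 0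
  /-- the upper right `l × l` block of the subleading coefficient of `L` is `I_l` -/
  sublead_L : ∀ i j : Fin q, (i : ℕ) < l → q - l ≤ (j : ℕ) →
    (L i j).coeff (NL - 1) = if (j : ℕ) = i + (q - l) then 1 else 0
  /-- the eigenvalues of `L` -/
  lam : Fin (numEig NL q l) → ℂ
  lam_injective : Function.Injective lam
  lam_roots : ∀ z : ℂ, (evalMat L z).det = 0 ↔ ∃ j, lam j = z
  /-- the eigenvalues of `R` -/
  rho : Fin (numEig NR p r) → ℂ
  rho_injective : Function.Injective rho
  rho_roots : ∀ z : ℂ, (evalMat R z).det = 0 ↔ ∃ i, rho i = z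
  /-- right eigenvectors of `L` -/
  lvec : Fin (numEig NL q l) → Fin q → ℂ
  lvec_ne_zero : ∀ j, lvec j ≠ 0
  lvec_eigen : ∀ j, Matrix.mulVec (evalMat L (lam j)) (lvec j) = 0
  /-- right eigenvectors of `R` -/
  rvec : Fin (numEig NR p r) → Fin p → ℂ
  rvec_ne_zero : ∀ i, rvec i ≠ 0
  rvec_eigen : ∀ i, Matrix.mulVec (evalMat R (rho i)) (rvec i) = 0
  /-- left eigenvectors of `R` -/
  rcovec : Fin (numEig NR p r) → Fin p → ℂ
  rcovec_ne_zero : ∀ i, rcovec i ≠ 0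
  rcovec_eigen : ∀ i, Matrix.vecMul (rcovec i) (evalMat R (rho i)) = 0
  /-- the arbitrary column vector functions of the discrete masses -/
  xi : Fin (numEig NR p r) → ℂ → Fin q → ℂ

namespace UvarovData

variable {q p NL l NR r : ℕ}

/-- The density, with respect to `base μ`, of `L dμ R⁻¹`. -/
def pertDensity (U : UvarovData q p NL l NR r) (μ : MatrixMeasure q p) (x : ℝ) :
    Matrix (Fin q) (Fin p) ℂ :=
  evalMat U.L x * density μ x * (evalMat U.R x)⁻¹

/-- `L dμ R⁻¹` is a well-defined matrix of measures with finite moments: `R` is invertible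
almost everywhere, and all moments of `L dμ R⁻¹` converge absolutely. -/
def PertWellDefined (U : UvarovData q p NL l NR r) (μ : MatrixMeasure q p) : Prop :=
  (∀ᵐ x : ℝ ∂(base μ), (evalMat U.R x).det ≠ 0) ∧
  ∀ (k : ℕ) (b : Fin q) (a : Fin p),
    Integrable (fun x : ℝ => (x : ℂ) ^ k * U.pertDensity μ x b a) (base μ)

/-- For every eigenvalue `ρ_i` of `R`, the Cauchy integral `∫ dμ(x) r_i / (ρ_i - x)` converges
absolutely, so that the numbers `D_n(ρ_i) r_i` exist. -/
def CauchyWellDefined (U : UvarovData q p NL l NR r) (μ : MatrixMeasure q p) : Prop :=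
  ∀ (i : Fin (numEig NR p r)) (b : Fin q),
    Integrable (fun x : ℝ => Matrix.mulVec (density μ x) (U.rvec i) b / (U.rho i - x)) (base μ)

/-- The bilinear functional `(f, g) ↦ ∫ f dμ̃ g` of the perturbed matrix of measures
`dμ̃ = L dμ R⁻¹ + ∑ i, L(x) ξ_i(x) r⃖_i δ(x - ρ_i)`, where `r⃖_i` is the left eigenvector. The
eigenvalues `ρ_i`, hence the point masses, may lie off the real line. -/
def pertPairing (U : UvarovData q p NL l NR r) (μ : MatrixMeasure q p)
    (f : Fin q → ℂ[X]) (g : Fin p → ℂ[X]) : ℂ :=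
  (∫ x : ℝ, evalVec f x ⬝ᵥ Matrix.mulVec (U.pertDensity μ x) (evalVec g x) ∂(base μ))
    + ∑ i, (evalVec f (U.rho i) ⬝ᵥ
        Matrix.mulVec (evalMat U.L (U.rho i)) (U.xi i (U.rho i)))
      * (U.rcovec i ⬝ᵥ evalVec g (U.rho i))

/-- The defining relation `dμ̃ R = L dμ` of the perturbation. -/
theorem pertPairing_mul (U : UvarovData q p NL l NR r) (μ : MatrixMeasure q p)
    (h : U.PertWellDefined μ) (f : Fin q → ℂ[X]) (g : Fin p → ℂ[X]) :
    U.pertPairing μ f (Matrix.mulVec U.R g) = pairing μ (Matrix.vecMul f U.L) g := by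
  have e1 : ∀ z, evalVec (Matrix.mulVec U.R g) z = Matrix.mulVec (evalMat U.R z) (evalVec g z) := by
    intro z; ext i
    simp [evalVec, evalMat, Matrix.mulVec, dotProduct, eval_finsetSum]
  have e2 : ∀ z, evalVec (Matrix.vecMul f U.L) z = Matrix.vecMul (evalVec f z) (evalMat U.L z) := by
    intro z; ext i
    simp [evalVec, evalMat, Matrix.vecMul, dotProduct, eval_finsetSum]
  unfold UvarovData.pertPairing pairing
  rw [Finset.sum_eq_zero, add_zero]
  · refine integral_congr_ae ?_
    filter_upwards [h.1] with x hx
    have hu : IsUnit (evalMat U.R x).det := isUnit_iff_ne_zero.2 hx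
    rw [e1, e2, UvarovData.pertDensity, Matrix.mulVec_mulVec, Matrix.mul_assoc,
      Matrix.nonsing_inv_mul _ hu, Matrix.mul_one, ← Matrix.mulVec_mulVec, Matrix.dotProduct_mulVec]
  · intro i _
    rw [e1, Matrix.dotProduct_mulVec (U.rcovec i), U.rcovec_eigen]
    simp
/-- The number `r⃖_i R'(ρ_i) r⃗_i`. -/
def pairR' (U : UvarovData q p NL l NR r) (i : Fin (numEig NR p r)) : ℂ :=
  U.rcovec i ⬝ᵥ Matrix.mulVec (evalDeriv U.R (U.rho i)) (U.rvec i)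

/-- `𝔹_n^{(j)} = B_n(λ_j) l⃗_j`. -/
def bbB (U : UvarovData q p NL l NR r) (B : ℕ → Fin q → ℂ[X]) (n : ℕ)
    (j : Fin (numEig NL q l)) : ℂ :=
  evalVec (B n) (U.lam j) ⬝ᵥ U.lvec j

/-- `𝔻_n^{(i)} = D_n(ρ_i) r⃗_i`. -/
def bbD (U : UvarovData q p NL l NR r) (μ : MatrixMeasure q p) (B : ℕ → Fin q → ℂ[X]) (n : ℕ)
    (i : Fin (numEig NR p r)) : ℂ :=
  cauchyD μ B n (U.rho i) (U.rvec i)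

/-- `𝕎_n^{(i)} = B_n(ρ_i) ξ_i(ρ_i) r⃖_i R'(ρ_i) r⃗_i`. -/
def bbW (U : UvarovData q p NL l NR r) (B : ℕ → Fin q → ℂ[X]) (n : ℕ)
    (i : Fin (numEig NR p r)) : ℂ :=
  (evalVec (B n) (U.rho i) ⬝ᵥ U.xi i (U.rho i)) * U.pairR' i

/-- `𝕂^{[N-1],(j)}(x) = K^{[N-1]}(x, λ_j) l⃗_j`. -/
def bbK (U : UvarovData q p NL l NR r) (A : ℕ → Fin p → ℂ[X]) (B : ℕ → Fin q → ℂ[X])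
    (N : ℕ) (j : Fin (numEig NL q l)) (x : ℂ) : Fin p → ℂ :=
  Matrix.mulVec (kernelK A B N x (U.lam j)) (U.lvec j)

/-- `𝕂_D^{[N-1],(i)}(x) =
K_D^{[N-1]}(x, ρ_i) r⃗_i - K^{[N-1]}(x, ρ_i) ξ_i(ρ_i) r⃖_i R'(ρ_i) r⃗_i`. -/
def bbKD (U : UvarovData q p NL l NR r) (μ : MatrixMeasure q p) (A : ℕ → Fin p → ℂ[X])
    (B : ℕ → Fin q → ℂ[X]) (N : ℕ) (i : Fin (numEig NR p r)) (x : ℂ) : Fin p → ℂ :=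
  fun a => kernelKD μ A B N x (U.rho i) (U.rvec i) a
    - Matrix.mulVec (kernelK A B N x (U.rho i)) (U.xi i (U.rho i)) a * U.pairR' i

/-- The row `(𝔹_n^{(1)}, …, 𝔹_n^{(M^L)}, 𝔻_n^{(1)} - 𝕎_n^{(1)}, …, 𝔻_n^{(M^R)} - 𝕎_n^{(M^R)})`. -/
def row (U : UvarovData q p NL l NR r) (μ : MatrixMeasure q p) (B : ℕ → Fin q → ℂ[X]) (n : ℕ) :
    Fin (numEig NL q l + numEig NR p r) → ℂ :=
  Fin.append (fun j => U.bbB B n j) (fun i => U.bbD μ B n i - U.bbW B n i)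

/-- The row with entries `𝕂_a^{[N-1],(j)}(x)` and
`𝕂_{D,a}^{[N-1],(i)}(x) + r⃗_{i,a} / (x - ρ_i)`. -/
def kernelRow (U : UvarovData q p NL l NR r) (μ : MatrixMeasure q p) (A : ℕ → Fin p → ℂ[X])
    (B : ℕ → Fin q → ℂ[X]) (N : ℕ) (a : Fin p) (x : ℂ) :
    Fin (numEig NL q l + numEig NR p r) → ℂ :=
  Fin.append (fun j => U.bbK A B N j x a)
    (fun i => U.bbKD μ A B N i x a + U.rvec i a / (x - U.rho i))

/-- The determinant `τ_n`, with rows of index `n - M^R, …, n + M^L - 1`. It is meant for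
`n ≥ M^R`. -/
def tau (U : UvarovData q p NL l NR r) (μ : MatrixMeasure q p) (B : ℕ → Fin q → ℂ[X]) (n : ℕ) : ℂ :=
  Matrix.det (Matrix.of fun k : Fin (numEig NL q l + numEig NR p r) =>
    U.row μ B (n - numEig NR p r + k))

/-- The determinant with rows of index `n - M^R, …, n + M^L - 2`, followed by the row of kernels
`𝕂_a^{[n-1-M^R]}`, `𝕂_{D,a}^{[n-1-M^R]}` at `x`. -/
def detA (U : UvarovData q p NL l NR r) (μ : MatrixMeasure q p) (A : ℕ → Fin p → ℂ[X])
    (B : ℕ → Fin q → ℂ[X]) (n : ℕ) (a : Fin p) (x : ℂ) : ℂ :=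
  Matrix.det (Matrix.of fun k : Fin (numEig NL q l + numEig NR p r) =>
    if (k : ℕ) + 1 < numEig NL q l + numEig NR p r then U.row μ B (n - numEig NR p r + k)
    else U.kernelRow μ A B (n - numEig NR p r) a x)

/-- The determinant with rows of index `n - M^R, …, n + M^L`, bordered on the right by the column
`B_{n-M^R}^{(b)}(x), …, B_{n+M^L}^{(b)}(x)`. -/
def detB (U : UvarovData q p NL l NR r) (μ : MatrixMeasure q p) (B : ℕ → Fin q → ℂ[X]) (n : ℕ)
    (b : Fin q) (x : ℂ) : ℂ :=
  Matrix.det (Matrix.of fun k : Fin (numEig NL q l + numEig NR p r + 1) =>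
    (Fin.snoc (α := fun _ => ℂ) (U.row μ B (n - numEig NR p r + k))
      ((B (n - numEig NR p r + k) b).eval x) :
        Fin (numEig NL q l + numEig NR p r + 1) → ℂ))

end UvarovData

end MixedMOP

end

open Polynomial MeasureTheory

noncomputable section

namespace MixedMOP

/-! Write `I` for the form of `μ` and `Ĩ` for that of the perturbation `μ̃`. The relation `dμ̃ R = L
dμ` gives `Ĩ(B̃_m, R A_k) = I(B̃_m L, A_k)`. This one number `c_{m,k}` (`connection`) is the
coefficient of `B_k` in `B̃_m L` and of `Ã_m` in `R A_k`. The normalizations of `L` and `R` make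
multiplication by them shift leading terms by exactly `M^L` and `M^R` steps (`IsMonicShift`). Hence
`c` is banded, `m - M^R ≤ k ≤ m + M^L`, with `c_{m,m+M^L} = 1`.

The row `v_k` is the value at `B_k` of a linear map `rowMap`. The key identity is `rowMap_vecMul_L`:
on `f L` the first `M^L` entries vanish, since `L(λ_j)` kills `l_j`, and the others are `-Ĩ(f, g_i)`
with the polynomial vector `g_i = R r_i / (x - ρ_i)` (`rquot`), which lies below step `M^R`.

Type II: for `n ≥ M^R`, `B̃_n` is orthogonal to every `g_i`, so `∑ c_{n,k} v_k = 0` over the `M^L +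
M^R + 1` indices of the band. As the last coefficient is `1`, the bordered determinant equals `τ_n`
times `B̃_n L` (`detB_eq`).

Type I: expand `∑_{m<n} Ã_m(x) B̃_m L` in the `B_k` and apply `rowMap`. The kernel of `μ̃`
reproduces `g_i`, so the result is `-(0, g_i(x))`. The coefficients with `k < n - M^R` are `R A_k`,
and these terms together with `g_i` make up `R(x)` times the kernel row. That product is therefore
minus a combination of the rows of `τ_n`, the last one with coefficient `Ã_{n-1}(x)`
(`sum_smul_kernelRow`), and multilinearity of the determinant concludes. -/

/-! ### The step-line filtration of vectors of polynomials -/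

/-- The span of the monomials `monomialRow k m` with `m < n`. -/
def stepSpace (k n : ℕ) : Submodule ℂ (Fin k → ℂ[X]) where
  carrier := {f | ∀ (b : Fin k) (j : ℕ), n ≤ j * k + b → (f b).coeff j = 0}
  add_mem' := by
    intro f g hf hg b j h
    simp [hf b j h, hg b j h]
  zero_mem' := by
    intro b j _
    simp
  smul_mem' := by
    intro c f hf b j h
    simp [hf b j h]

theorem stepSpace_mono {k m n : ℕ} (h : m ≤ n) : stepSpace k m ≤ stepSpace k n :=
  fun _ hf b j hj => hf b j (h.trans hj)

theorem eq_mul_add_iff {k n j b : ℕ} (hb : b < k) : n = j * k + b ↔ n % k = b ∧ n / k = j := by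
  constructor
  · rintro rfl
    refine ⟨?_, ?_⟩
    · rw [Nat.mul_add_mod', Nat.mod_eq_of_lt hb]
    · rw [Nat.add_comm, Nat.add_mul_div_right _ _ (by omega), Nat.div_eq_of_lt hb, Nat.zero_add]
  · rintro ⟨rfl, rfl⟩
    rw [Nat.mul_comm]
    exact (Nat.div_add_mod n k).symm

theorem coeff_monomialRow (k n j : ℕ) (b : Fin k) :
    (monomialRow k n b).coeff j = if n = j * k + b then 1 else 0 := by
  unfold monomialRow
  simp only [eq_mul_add_iff b.2]
  by_cases h : n % k = b
  · simp [h, coeff_X_pow, eq_comm]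
  · simp [h]

theorem monomialRow_mem {k m n : ℕ} (h : m < n) : monomialRow k m ∈ stepSpace k n := by
  intro b j hj
  rw [coeff_monomialRow, if_neg (by omega)]

theorem eq_zero_of_mem_stepSpace_zero {k : ℕ} {f : Fin k → ℂ[X]} (hf : f ∈ stepSpace k 0) :
    f = 0 := by
  ext b j
  exact hf b j (Nat.zero_le _)

theorem exists_sub_smul_mem {k n : ℕ} (hk : 0 < k) {f : Fin k → ℂ[X]}
    (hf : f ∈ stepSpace k (n + 1)) : ∃ c : ℂ, f - c • monomialRow k n ∈ stepSpace k n := by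
  refine ⟨(f ⟨n % k, Nat.mod_lt _ hk⟩).coeff (n / k), fun b j hj => ?_⟩
  rw [Pi.sub_apply, Pi.smul_apply, coeff_sub, coeff_smul, coeff_monomialRow]
  by_cases h : n = j * k + b
  · obtain ⟨h1, h2⟩ := (eq_mul_add_iff b.2).1 h
    rw [if_pos h]
    simp [h1, h2]
  · rw [if_neg h, hf b j (by omega)]
    simp

/-- A sequence of vectors of polynomials whose leading terms are the nonzero multiples
`c n • monomialRow k n` spans the step-line filtration. -/
theorem exists_eq_sum_of_mem {k : ℕ} (hk : 0 < k) {e : ℕ → Fin k → ℂ[X]} {c : ℕ → ℂ}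
    (hc : ∀ n, c n ≠ 0) (he : ∀ n, e n - c n • monomialRow k n ∈ stepSpace k n) {N : ℕ}
    {f : Fin k → ℂ[X]} (hf : f ∈ stepSpace k N) :
    ∃ a : ℕ → ℂ, f = ∑ m ∈ Finset.range N, a m • e m := by
  induction N generalizing f with
  | zero => exact ⟨0, by simpa using eq_zero_of_mem_stepSpace_zero hf⟩
  | succ N ih =>
    obtain ⟨d, hd⟩ := exists_sub_smul_mem hk hf
    have h1 : f - (d / c N) • e N ∈ stepSpace k N := by
      have := sub_mem hd (Submodule.smul_mem _ (d / c N) (he N))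
      rwa [smul_sub, smul_smul, div_mul_cancel₀ _ (hc N), sub_sub_sub_cancel_right] at this
    obtain ⟨a, ha⟩ := ih h1
    refine ⟨fun m => if m < N then a m else d / c N, ?_⟩
    rw [Finset.sum_range_succ, eq_add_of_sub_eq ha]
    simp only [lt_irrefl, if_false]
    congr 1
    exact Finset.sum_congr rfl fun m hm => by rw [if_pos (Finset.mem_range.1 hm)]

/-! ### Biorthogonal expansions -/

section Biorthogonal

variable {k k' : ℕ} {I : (Fin k → ℂ[X]) →ₗ[ℂ] (Fin k' → ℂ[X]) →ₗ[ℂ] ℂ}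
  {e : ℕ → Fin k → ℂ[X]} {e' : ℕ → Fin k' → ℂ[X]} {c : ℕ → ℂ}

/-- Some expansion in the `e m` exists by triangularity; pairing it with `e' m` identifies the
coefficients. The form is left abstract so that the statement also applies to its flip. -/
theorem eq_sum_of_biorthogonal (hk : 0 < k) (hc : ∀ n, c n ≠ 0)
    (he : ∀ n, e n - c n • monomialRow k n ∈ stepSpace k n)
    (h : ∀ n m, I (e n) (e' m) = if n = m then 1 else 0) {N : ℕ} {f : Fin k → ℂ[X]}
    (hf : f ∈ stepSpace k N) : f = ∑ m ∈ Finset.range N, I f (e' m) • e m := by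
  obtain ⟨a, ha⟩ := exists_eq_sum_of_mem hk hc he hf
  rw [ha]
  refine Finset.sum_congr rfl fun m hm => ?_
  simp only [map_sum, map_smul, LinearMap.sum_apply, LinearMap.smul_apply, h, smul_eq_mul, mul_ite,
    mul_one, mul_zero, Finset.sum_ite_eq', hm, if_true]

theorem eq_zero_of_biorthogonal (hk : 0 < k) (hc : ∀ n, c n ≠ 0)
    (he : ∀ n, e n - c n • monomialRow k n ∈ stepSpace k n)
    (h : ∀ n m, I (e n) (e' m) = if n = m then 1 else 0) {N : ℕ} {f : Fin k → ℂ[X]}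
    (hf : f ∈ stepSpace k N) : I f (e' N) = 0 := by
  obtain ⟨a, ha⟩ := exists_eq_sum_of_mem hk hc he hf
  rw [ha]
  simp [h]

end Biorthogonal

/-! ### Polynomials of a Gauss–Borel factorization: leading terms and biorthogonality -/

theorem det_trunc_eq_one {S : Matrix ℕ ℕ ℂ} (hS : IsLowerUnitriangular S) (N : ℕ) :
    (trunc N S).det = 1 := by
  have h : (trunc N S).IsLowerTriangular := fun i j hij => hS.2 _ _ hij
  rw [Matrix.det_of_isLowerTriangular _ h]
  simp [trunc, hS.1]

theorem polyB_eq_sum {q N n : ℕ} {S : Matrix ℕ ℕ ℂ} (hS : IsLowerUnitriangular S) (h : n < N) :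
    polyB q S n = ∑ i : Fin N, S n i • monomialRow q i := by
  rw [Finset.sum_fin_eq_sum_range, ← Finset.sum_subset (Finset.range_mono (Nat.succ_le_of_lt h))]
  · ext1 b
    simp only [polyB, Finset.sum_apply]
    refine Finset.sum_congr rfl fun m hm => ?_
    rw [dif_pos (by simp at hm; omega), Pi.smul_apply, smul_eq_C_mul]
  · intro m hm hm'
    simp only [Finset.mem_range] at hm hm'
    rw [dif_pos hm, hS.2 n m (by simpa using hm'), zero_smul]

theorem polyA_eq_smul_polyB (p : ℕ) (H : ℕ → ℂ) (Sbar : Matrix ℕ ℕ ℂ) (n : ℕ) :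
    polyA p H Sbar n = (H n)⁻¹ • polyB p Sbar n := by
  ext1 a
  simp only [polyA, polyB, Pi.smul_apply, Finset.smul_sum, smul_eq_C_mul]
  exact Finset.sum_congr rfl fun m _ => by rw [C_mul]; ring

theorem polyB_sub_mem {q n : ℕ} {S : Matrix ℕ ℕ ℂ} (hS : IsLowerUnitriangular S) :
    polyB q S n - (1 : ℂ) • monomialRow q n ∈ stepSpace q n := by
  rw [polyB_eq_sum hS n.lt_succ_self, Fin.sum_univ_castSucc]
  simp only [Fin.val_castSucc, Fin.val_last, hS.1, add_sub_cancel_right]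
  exact Submodule.sum_mem _ fun i _ => Submodule.smul_mem _ _ (monomialRow_mem i.2)

theorem polyA_sub_mem {p n : ℕ} {Sbar : Matrix ℕ ℕ ℂ} {H : ℕ → ℂ}
    (hS : IsLowerUnitriangular Sbar) :
    polyA p H Sbar n - (H n)⁻¹ • monomialRow p n ∈ stepSpace p n := by
  rw [polyA_eq_smul_polyB, ← smul_sub]
  simpa using Submodule.smul_mem _ (H n)⁻¹ (polyB_sub_mem hS)

theorem mem_stepSpace_of_sub_mem {k n : ℕ} {c : ℂ} {f : Fin k → ℂ[X]}
    (h : f - c • monomialRow k n ∈ stepSpace k n) : f ∈ stepSpace k (n + 1) := by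
  have := add_mem (stepSpace_mono n.le_succ h)
    (Submodule.smul_mem _ c (monomialRow_mem (k := k) n.lt_succ_self))
  rwa [sub_add_cancel] at this

/-- The polynomials given by a Gauss–Borel factorization of the moment matrix are biorthogonal. -/
theorem IsGaussBorel.biorthogonal {q p : ℕ} {I : (Fin q → ℂ[X]) →ₗ[ℂ] (Fin p → ℂ[X]) →ₗ[ℂ] ℂ}
    {S Sbar : Matrix ℕ ℕ ℂ} {H : ℕ → ℂ}
    (hM : IsGaussBorel (momentMatrix fun f g => I f g) S H Sbar) (n m : ℕ) :
    I (polyB q S n) (polyA p H Sbar m) = if n = m then 1 else 0 := by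
  set N := max n m + 1
  have hn : n < N := by omega
  have hm : m < N := by omega
  -- The factorization solved for `H`: entry `(n, m)` of the left side is the pairing of `B_n` with
  -- `H_m A_m`.
  have hd : trunc N S * trunc N (momentMatrix fun f g => I f g) * (trunc N Sbar).transpose
      = Matrix.diagonal fun i : Fin N => H i := by
    have h1 : trunc N S * (trunc N S)⁻¹ = 1 :=
      Matrix.mul_nonsing_inv _ (by simp [det_trunc_eq_one hM.lower])
    have h2 : ((trunc N Sbar)⁻¹).transpose * (trunc N Sbar).transpose = 1 := by
      rw [← Matrix.transpose_mul, Matrix.mul_nonsing_inv _ (by simp [det_trunc_eq_one hM.lower_bar]),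
        Matrix.transpose_one]
    rw [hM.factor N, Matrix.mul_assoc, Matrix.mul_assoc, Matrix.mul_assoc, h2, Matrix.mul_one,
      ← Matrix.mul_assoc, h1, Matrix.one_mul]
  have he := congrFun (congrFun hd ⟨n, hn⟩) ⟨m, hm⟩
  rw [polyA_eq_smul_polyB, polyB_eq_sum hM.lower hn, polyB_eq_sum hM.lower_bar hm]
  have h3 : I (∑ i : Fin N, S n i • monomialRow q i) (∑ j : Fin N, Sbar m j • monomialRow p j)
      = if n = m then H n else 0 := by
    rw [Matrix.diagonal_apply] at he
    simp only [Fin.mk.injEq] at he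
    rw [← he]
    simp only [Matrix.mul_apply, Matrix.transpose_apply, trunc, Matrix.submatrix_apply,
      momentMatrix, Matrix.of_apply, map_sum, map_smul, LinearMap.sum_apply, LinearMap.smul_apply,
      smul_eq_mul]
    refine Finset.sum_congr rfl fun j _ => ?_
    rw [mul_comm]
  rw [map_smul, h3, smul_eq_mul]
  split_ifs with h
  · rw [h, inv_mul_cancel₀ (hM.diag_ne_zero m)]
  · rw [mul_zero]

/-! ### Multiplication by matrix polynomials with normalized leading coefficients -/

/-- The matrix polynomial `T` shifts the leading term by `M` steps: `monomialRow k n * T` is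
`monomialRow k (n + M)` up to lower terms. -/
def IsMonicShift {k : ℕ} (T : Matrix (Fin k) (Fin k) ℂ[X]) (M : ℕ) : Prop :=
  ∀ (b j : Fin k) (s : ℕ), b + M ≤ s * k + j →
    (T b j).coeff s = if s * k + j = b + M then 1 else 0

theorem IsMonicShift.monomialRow_sub_mem {k M : ℕ} {T : Matrix (Fin k) (Fin k) ℂ[X]}
    (hT : IsMonicShift T M) (hk : 0 < k) (n : ℕ) :
    Matrix.vecMul (monomialRow k n) T - (1 : ℂ) • monomialRow k (n + M) ∈ stepSpace k (n + M) := by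
  intro j t ht
  have h1 : Matrix.vecMul (monomialRow k n) T j
      = X ^ (n / k) * T ⟨n % k, Nat.mod_lt _ hk⟩ j := by
    rw [Matrix.vecMul, dotProduct, Finset.sum_eq_single ⟨n % k, Nat.mod_lt _ hk⟩]
    · simp [monomialRow]
    · intro b _ hb
      have : n % k ≠ b := fun h => hb (Fin.ext h.symm)
      simp [monomialRow, this]
    · simp
  have hn := Nat.div_add_mod n k
  rw [Pi.sub_apply, Pi.smul_apply, one_smul, coeff_sub, coeff_monomialRow, h1, coeff_X_pow_mul']
  -- The product is row `n % k` of `T` times `X ^ (n / k)`. Coefficients of degree below `n / k`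
  -- vanish, and there `t * k + j < n`, so the subtracted monomial does not contribute either.
  by_cases hle : n / k ≤ t
  · obtain ⟨s, rfl⟩ := Nat.exists_eq_add_of_le hle
    have e1 : (n / k + s) * k = k * (n / k) + s * k := by ring
    rw [e1] at ht ⊢
    rw [if_pos hle, Nat.add_sub_cancel_left, hT _ _ _ (by simp only; omega)]
    simp only
    split_ifs <;> first | omega | simp
  · rw [if_neg hle, zero_sub, neg_eq_zero, if_neg]
    intro he
    have : (t + 1) * k ≤ n / k * k := Nat.mul_le_mul_right _ (by omega)
    have e2 : (t + 1) * k = t * k + k := by ring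
    have e3 : n / k * k = k * (n / k) := by ring
    have := j.2
    omega

theorem IsMonicShift.vecMul_mem {k M n : ℕ} {T : Matrix (Fin k) (Fin k) ℂ[X]}
    (hT : IsMonicShift T M) (hk : 0 < k) {f : Fin k → ℂ[X]} (hf : f ∈ stepSpace k n) :
    Matrix.vecMul f T ∈ stepSpace k (n + M) := by
  obtain ⟨a, rfl⟩ := exists_eq_sum_of_mem hk (e := monomialRow k) (c := fun _ => 1)
    (fun _ => one_ne_zero) (fun n => by simp) hf
  rw [Matrix.sum_vecMul]
  refine Submodule.sum_mem _ fun m hm => ?_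
  rw [Matrix.smul_vecMul]
  refine Submodule.smul_mem _ _ (stepSpace_mono ?_
    (mem_stepSpace_of_sub_mem (hT.monomialRow_sub_mem hk m)))
  have := Finset.mem_range.1 hm
  omega

theorem IsMonicShift.vecMul_sub_mem {k M n : ℕ} {T : Matrix (Fin k) (Fin k) ℂ[X]}
    (hT : IsMonicShift T M) (hk : 0 < k) {c : ℂ} {f : Fin k → ℂ[X]}
    (hf : f - c • monomialRow k n ∈ stepSpace k n) :
    Matrix.vecMul f T - c • monomialRow k (n + M) ∈ stepSpace k (n + M) := by
  have h := add_mem (hT.vecMul_mem hk hf)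
    (Submodule.smul_mem _ c (hT.monomialRow_sub_mem hk n))
  rwa [Matrix.sub_vecMul, Matrix.smul_vecMul, one_smul, smul_sub, sub_add_sub_cancel] at h

/-- Division by `X - z` lowers the step-line filtration by `k` steps. -/
theorem mem_stepSpace_of_X_sub_C_mul {k n : ℕ} {z : ℂ} {f : Fin k → ℂ[X]}
    (h : (fun b => (X - C z) * f b) ∈ stepSpace k (n + k)) : f ∈ stepSpace k n := by
  intro b j hj
  have h1 : ((X - C z) * f b).degree < ((j + 1 : ℕ) : WithBot ℕ) := by
    rw [degree_lt_iff_coeff_zero]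
    intro m hm
    refine h b m ?_
    have : (j + 1) * k ≤ m * k := Nat.mul_le_mul_right _ hm
    have e : (j + 1) * k = j * k + k := by ring
    omega
  by_cases h0 : f b = 0
  · simp [h0]
  · rw [degree_mul, degree_X_sub_C, degree_eq_natDegree h0] at h1
    have h2 : 1 + (f b).natDegree < j + 1 := by exact_mod_cast h1
    exact coeff_eq_zero_of_natDegree_lt (by omega)

namespace UvarovData

variable {q p NL l NR r : ℕ}

/-- The subtraction in `numEig` does not truncate. The only danger is `NL = 0` with `l > 0`; then
row `0` of `L` vanishes at `0`, which forces an eigenvalue although their index type is empty. -/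
theorem numEig_left_add (U : UvarovData q p NL l NR r) : numEig NL q l + l = NL * q := by
  have hl := U.l_lt
  rcases Nat.eq_zero_or_pos NL with rfl | h
  · suffices l = 0 by simp [numEig, this]
    by_contra h0
    have hz : (evalMat U.L 0).det = 0 := by
      refine Matrix.det_eq_zero_of_row_eq_zero ⟨0, by omega⟩ fun j => ?_
      have h1 := U.lead_L ⟨0, by omega⟩ j
      rw [if_neg (by simp only; omega)] at h1
      simp [evalMat, ← coeff_zero_eq_eval_zero, h1]
    obtain ⟨j, -⟩ := (U.lam_roots 0).1 hz
    exact absurd j.2 (by simp [numEig])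
  · have : 1 * q ≤ NL * q := Nat.mul_le_mul_right _ h
    unfold numEig
    omega

theorem numEig_right_add (U : UvarovData q p NL l NR r) : numEig NR p r + r = NR * p := by
  have hr := U.r_lt
  rcases Nat.eq_zero_or_pos NR with rfl | h
  · suffices r = 0 by simp [numEig, this]
    by_contra h0
    have hz : (evalMat U.R 0).det = 0 := by
      refine Matrix.det_eq_zero_of_column_eq_zero ⟨0, by omega⟩ fun j => ?_
      have h1 := U.lead_R j ⟨0, by omega⟩
      rw [if_neg (by simp only; omega)] at h1
      simp [evalMat, ← coeff_zero_eq_eval_zero, h1]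
    obtain ⟨j, -⟩ := (U.rho_roots 0).1 hz
    exact absurd j.2 (by simp [numEig])
  · have : 1 * p ≤ NR * p := Nat.mul_le_mul_right _ h
    unfold numEig
    omega

end UvarovData

/-- With `M = N k - s`, the condition `b + M ≤ t k + j` leaves only `t ≥ N - 1`. For `t = N - 1` it
reads `b + k ≤ j + s`, so `b < s` and `j ≥ k - s`: precisely the corner block of the subleading
coefficient that is normalized. -/
theorem isMonicShift_of_coeff {k N s M : ℕ} {T : Matrix (Fin k) (Fin k) ℂ[X]} (hs : s < k)
    (hM : M + s = N * k) (hdeg : ∀ i j, (T i j).natDegree ≤ N)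
    (hlead : ∀ i j : Fin k, (T i j).coeff N = if (i : ℕ) = j + s then 1 else 0)
    (hsub : ∀ i j : Fin k, (i : ℕ) < s → k - s ≤ (j : ℕ) →
      (T i j).coeff (N - 1) = if (j : ℕ) = i + (k - s) then 1 else 0) :
    IsMonicShift T M := by
  intro b j t ht
  have hb := b.2
  have hj := j.2
  rcases lt_trichotomy t N with h | rfl | h
  · obtain ⟨d, rfl⟩ := Nat.exists_eq_add_of_lt h
    have e : (t + d + 1) * k = t * k + d * k + k := by ring
    rw [e] at hM
    rcases Nat.eq_zero_or_pos d with rfl | hd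
    · have := hsub b j (by omega) (by omega)
      simp only [add_zero, Nat.add_sub_cancel] at this
      rw [this]
      split_ifs <;> first | rfl | omega
    · have : 1 * k ≤ d * k := Nat.mul_le_mul_right _ hd
      omega
  · rw [hlead]
    split_ifs <;> first | rfl | omega
  · rw [coeff_eq_zero_of_natDegree_lt (lt_of_le_of_lt (hdeg b j) h), if_neg]
    have : (N + 1) * k ≤ t * k := Nat.mul_le_mul_right _ h
    have e : (N + 1) * k = N * k + k := by ring
    omega

namespace UvarovData

variable {q p NL l NR r : ℕ} (U : UvarovData q p NL l NR r)

theorem isMonicShift_L : IsMonicShift U.L (numEig NL q l) :=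
  isMonicShift_of_coeff U.l_lt U.numEig_left_add U.degree_L U.lead_L U.sublead_L

theorem isMonicShift_R : IsMonicShift U.R.transpose (numEig NR p r) :=
  isMonicShift_of_coeff U.r_lt U.numEig_right_add (fun i j => U.degree_R j i)
    (fun i j => U.lead_R j i) fun i j hi hj => U.sublead_R j i hj hi

end UvarovData


/-! ### The bilinear forms of the two matrices of measures -/

theorem integrable_eval_mul {ν : Measure ℝ} {φ : ℝ → ℂ}
    (h : ∀ k : ℕ, Integrable (fun x : ℝ => (x : ℂ) ^ k * φ x) ν) (P : ℂ[X]) :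
    Integrable (fun x : ℝ => P.eval (x : ℂ) * φ x) ν := by
  have : (fun x : ℝ => P.eval (x : ℂ) * φ x)
      = fun x : ℝ => ∑ k ∈ Finset.range (P.natDegree + 1), P.coeff k * ((x : ℂ) ^ k * φ x) := by
    ext x
    rw [eval_eq_sum_range, Finset.sum_mul]
    exact Finset.sum_congr rfl fun k _ => mul_assoc _ _ _
  rw [this]
  exact integrable_finsetSum _ fun k _ => (h k).const_mul _

section Form

variable {q p : ℕ} {ν : Measure ℝ} {w : ℝ → Matrix (Fin q) (Fin p) ℂ}

theorem integrable_dotProduct_mulVec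
    (h : ∀ (k : ℕ) b a, Integrable (fun x : ℝ => (x : ℂ) ^ k * w x b a) ν)
    (f : Fin q → ℂ[X]) (g : Fin p → ℂ[X]) :
    Integrable (fun x : ℝ => evalVec f x ⬝ᵥ Matrix.mulVec (w x) (evalVec g x)) ν := by
  have : (fun x : ℝ => evalVec f x ⬝ᵥ Matrix.mulVec (w x) (evalVec g x))
      = fun x : ℝ => ∑ b, ∑ a, (f b * g a).eval (x : ℂ) * w x b a := by
    ext x
    simp only [dotProduct, Matrix.mulVec, evalVec, Finset.mul_sum, eval_mul]
    exact Finset.sum_congr rfl fun b _ => Finset.sum_congr rfl fun a _ => by ring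
  rw [this]
  exact integrable_finsetSum _ fun b _ => integrable_finsetSum _ fun a _ =>
    integrable_eval_mul (fun k => h k b a) _

theorem evalVec_add {k : ℕ} (f g : Fin k → ℂ[X]) (x : ℂ) :
    evalVec (f + g) x = evalVec f x + evalVec g x := by
  ext; simp [evalVec]

theorem evalVec_smul {k : ℕ} (c : ℂ) (f : Fin k → ℂ[X]) (x : ℂ) :
    evalVec (c • f) x = c • evalVec f x := by
  ext; simp [evalVec]

theorem evalVec_sum {k : ℕ} {ι : Type*} (s : Finset ι) (f : ι → Fin k → ℂ[X]) (x : ℂ) :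
    evalVec (∑ i ∈ s, f i) x = ∑ i ∈ s, evalVec (f i) x := by
  ext; simp [evalVec, eval_finsetSum]

theorem evalVec_mulVec {k : ℕ} (T : Matrix (Fin k) (Fin k) ℂ[X]) (g : Fin k → ℂ[X]) (x : ℂ) :
    evalVec (Matrix.mulVec T g) x = Matrix.mulVec (evalMat T x) (evalVec g x) := by
  ext; simp [evalVec, evalMat, Matrix.mulVec, dotProduct, eval_finsetSum]

theorem evalVec_vecMul {k : ℕ} (T : Matrix (Fin k) (Fin k) ℂ[X]) (f : Fin k → ℂ[X]) (x : ℂ) :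
    evalVec (Matrix.vecMul f T) x = Matrix.vecMul (evalVec f x) (evalMat T x) := by
  ext; simp [evalVec, evalMat, Matrix.vecMul, dotProduct, eval_finsetSum]

/-- The bilinear form `(f, g) ↦ ∫ f w g dν`. -/
def integralForm (h : ∀ (k : ℕ) b a, Integrable (fun x : ℝ => (x : ℂ) ^ k * w x b a) ν) :
    (Fin q → ℂ[X]) →ₗ[ℂ] (Fin p → ℂ[X]) →ₗ[ℂ] ℂ :=
  LinearMap.mk₂ ℂ (fun f g => ∫ x : ℝ, evalVec f x ⬝ᵥ Matrix.mulVec (w x) (evalVec g x) ∂ν)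
    (fun f f' g => by
      simp only [evalVec_add, add_dotProduct]
      exact integral_add (integrable_dotProduct_mulVec h f g) (integrable_dotProduct_mulVec h f' g))
    (fun c f g => by
      simp only [evalVec_smul, smul_dotProduct]
      exact integral_smul c _)
    (fun f g g' => by
      simp only [evalVec_add, Matrix.mulVec_add, dotProduct_add]
      exact integral_add (integrable_dotProduct_mulVec h f g) (integrable_dotProduct_mulVec h f g'))
    (fun c f g => by
      simp only [evalVec_smul, Matrix.mulVec_smul, dotProduct_smul]
      exact integral_smul c _)

end Form

/-- The bilinear form `(f, g) ↦ f(z) u v g(z)` of a point mass `u v δ(x - z)` of rank one. -/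
def pointForm {q p : ℕ} (z : ℂ) (u : Fin q → ℂ) (v : Fin p → ℂ) :
    (Fin q → ℂ[X]) →ₗ[ℂ] (Fin p → ℂ[X]) →ₗ[ℂ] ℂ :=
  LinearMap.mk₂ ℂ (fun f g => (evalVec f z ⬝ᵥ u) * (v ⬝ᵥ evalVec g z))
    (fun f f' g => by simp only [evalVec_add, add_dotProduct, add_mul])
    (fun c f g => by simp only [evalVec_smul, smul_dotProduct, smul_mul_assoc])
    (fun f g g' => by simp only [evalVec_add, dotProduct_add, mul_add])
    (fun c f g => by simp only [evalVec_smul, dotProduct_smul, mul_smul_comm])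

namespace UvarovData

variable {q p NL l NR r : ℕ} (U : UvarovData q p NL l NR r) {μ : MatrixMeasure q p}

/-- `pertPairing` as a bilinear form. -/
def pertForm (h : U.PertWellDefined μ) : (Fin q → ℂ[X]) →ₗ[ℂ] (Fin p → ℂ[X]) →ₗ[ℂ] ℂ :=
  integralForm h.2 + ∑ i, pointForm (U.rho i)
    (Matrix.mulVec (evalMat U.L (U.rho i)) (U.xi i (U.rho i))) (U.rcovec i)

theorem pertForm_apply (h : U.PertWellDefined μ) (f : Fin q → ℂ[X]) (g : Fin p → ℂ[X]) :
    U.pertForm h f g = U.pertPairing μ f g := by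
  simp only [pertForm, LinearMap.add_apply, LinearMap.sum_apply]
  rfl

theorem pertForm_mulVec (h : U.PertWellDefined μ) (hμ : HasMoments μ) (f : Fin q → ℂ[X])
    (g : Fin p → ℂ[X]) : U.pertForm h f (Matrix.mulVec U.R g)
      = integralForm hμ (Matrix.vecMul f U.L) g := by
  rw [pertForm_apply, U.pertPairing_mul μ h]
  rfl

/-! ### Divided differences of `R` at its eigenvalues -/

/-- The vector of polynomials `R(x) r_i / (x - ρ_i)`. -/
def rquot (i : Fin (numEig NR p r)) : Fin p → ℂ[X] :=
  fun a => Matrix.mulVec U.R (fun a' => C (U.rvec i a')) a /ₘ (X - C (U.rho i))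

theorem X_sub_C_mul_rquot (i : Fin (numEig NR p r)) (a : Fin p) :
    (X - C (U.rho i)) * U.rquot i a = Matrix.mulVec U.R (fun a' => C (U.rvec i a')) a := by
  refine mul_divByMonic_eq_iff_isRoot.2 ?_
  have := congrFun (U.rvec_eigen i) a
  have h2 := congrFun (evalVec_mulVec U.R (fun a' => C (U.rvec i a')) (U.rho i)) a
  have h3 : evalVec (fun a' => C (U.rvec i a')) (U.rho i) = U.rvec i := by ext; simp [evalVec]
  rw [h3, this] at h2
  exact h2

theorem evalMat_R_mulVec_rvec (i : Fin (numEig NR p r)) (x : ℂ) :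
    Matrix.mulVec (evalMat U.R x) (U.rvec i) = (x - U.rho i) • evalVec (U.rquot i) x := by
  have h2 := evalVec_mulVec U.R (fun a' => C (U.rvec i a')) x
  have h3 : evalVec (fun a' => C (U.rvec i a')) x = U.rvec i := by ext; simp [evalVec]
  rw [← h3, ← h2]
  ext a
  simp [evalVec, ← X_sub_C_mul_rquot]

theorem evalVec_rquot_rho (i : Fin (numEig NR p r)) :
    evalVec (U.rquot i) (U.rho i) = Matrix.mulVec (evalDeriv U.R (U.rho i)) (U.rvec i) := by
  ext a
  have h := congrArg (fun P => (derivative P).eval (U.rho i)) (U.X_sub_C_mul_rquot i a)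
  simpa [derivative_mul, Matrix.mulVec, dotProduct, evalVec, evalDeriv, derivative_sum,
    eval_finsetSum] using h

/-- The constant vector `r_i` lies below step `p`; multiplication by `R` adds `M^R` steps and
division by `x - ρ_i` removes `p`. -/
theorem rquot_mem (i : Fin (numEig NR p r)) : U.rquot i ∈ stepSpace p (numEig NR p r) := by
  refine mem_stepSpace_of_X_sub_C_mul (z := U.rho i) ?_
  have h : (fun a' => C (U.rvec i a')) ∈ stepSpace p p := by
    intro b j hj
    rw [coeff_C, if_neg]
    rintro rfl
    have := b.2
    omega
  have h2 := U.isMonicShift_R.vecMul_mem (by have := U.r_lt; omega) h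
  rw [Matrix.vecMul_transpose, add_comm] at h2
  simpa only [X_sub_C_mul_rquot] using h2

/-- Since the eigenvalues are distinct, the mass at `ρ_{i'}` sees only its own `g_i`. This is why
`𝕎^{(i)}` involves the single mass at `ρ_i`. -/
theorem rcovec_dotProduct_rquot (i i' : Fin (numEig NR p r)) :
    U.rcovec i' ⬝ᵥ evalVec (U.rquot i) (U.rho i') = if i' = i then U.pairR' i else 0 := by
  split_ifs with h
  · subst h
    rw [evalVec_rquot_rho]
    rfl
  · have h1 := congrArg (fun v => U.rcovec i' ⬝ᵥ v) (U.evalMat_R_mulVec_rvec i (U.rho i'))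
    simp only [Matrix.dotProduct_mulVec, U.rcovec_eigen, zero_dotProduct, dotProduct_smul,
      smul_eq_mul] at h1
    exact (mul_eq_zero.1 h1.symm).resolve_left (sub_ne_zero.2 fun e => h (U.rho_injective e))

/-! ### The functional whose values on `B_n` are the rows -/

theorem ae_ne_rho (h : U.PertWellDefined μ) (i : Fin (numEig NR p r)) :
    ∀ᵐ x : ℝ ∂(base μ), (x : ℂ) ≠ U.rho i := by
  filter_upwards [h.1] with x hx he
  exact hx ((U.rho_roots _).2 ⟨i, he.symm⟩)

/-- Only the Cauchy integral itself is assumed to converge; powers follow by induction from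
`x^{k+1}/(ρ - x) = ρ x^k/(ρ - x) - x^k`, valid almost everywhere even if `ρ_i` lies on the support.
-/
theorem integrable_cauchy (hμ : HasMoments μ) (hpert : U.PertWellDefined μ)
    (hcauchy : U.CauchyWellDefined μ) (f : Fin q → ℂ[X]) (i : Fin (numEig NR p r)) :
    Integrable (fun x : ℝ => (evalVec f x ⬝ᵥ Matrix.mulVec (density μ x) (U.rvec i))
      / (U.rho i - x)) (base μ) := by
  have hm : ∀ (k : ℕ) (b : Fin q), Integrable (fun x : ℝ =>
      (x : ℂ) ^ k * Matrix.mulVec (density μ x) (U.rvec i) b) (base μ) := by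
    intro k b
    have : (fun x : ℝ => (x : ℂ) ^ k * Matrix.mulVec (density μ x) (U.rvec i) b)
        = fun x : ℝ => ∑ a, ((x : ℂ) ^ k * density μ x b a) * U.rvec i a := by
      ext x
      simp only [Matrix.mulVec, dotProduct, Finset.mul_sum, mul_assoc]
    rw [this]
    exact integrable_finsetSum _ fun a _ => (hμ k b a).mul_const _
  have hc : ∀ (b : Fin q) (k : ℕ), Integrable (fun x : ℝ =>
      (x : ℂ) ^ k * (Matrix.mulVec (density μ x) (U.rvec i) b / (U.rho i - x))) (base μ) := by
    intro b k
    induction k with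
    | zero => simpa using hcauchy i b
    | succ k ih =>
      refine ((ih.const_mul (U.rho i)).sub (hm k b)).congr ?_
      filter_upwards [U.ae_ne_rho hpert i] with x hx
      have hx' : U.rho i - x ≠ 0 := sub_ne_zero.2 hx.symm
      simp only [Pi.sub_apply]
      field_simp
      ring
  have : (fun x : ℝ => (evalVec f x ⬝ᵥ Matrix.mulVec (density μ x) (U.rvec i)) / (U.rho i - x))
      = fun x : ℝ => ∑ b, (f b).eval (x : ℂ)
        * (Matrix.mulVec (density μ x) (U.rvec i) b / (U.rho i - x)) := by
    ext x
    simp only [dotProduct, evalVec, Finset.sum_div, mul_div_assoc]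
  rw [this]
  exact integrable_finsetSum _ fun b _ => integrable_eval_mul (hc b) _

/-- The linear map sending `B_n` to the row of index `n`. -/
def rowMap (hμ : HasMoments μ) (hpert : U.PertWellDefined μ) (hcauchy : U.CauchyWellDefined μ) :
    (Fin q → ℂ[X]) →ₗ[ℂ] (Fin (numEig NL q l + numEig NR p r) → ℂ) where
  toFun f := Fin.append (fun j => evalVec f (U.lam j) ⬝ᵥ U.lvec j) fun i =>
    (∫ x : ℝ, (evalVec f x ⬝ᵥ Matrix.mulVec (density μ x) (U.rvec i)) / (U.rho i - x) ∂(base μ))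
      - (evalVec f (U.rho i) ⬝ᵥ U.xi i (U.rho i)) * U.pairR' i
  map_add' f g := by
    ext k
    refine Fin.addCases (fun j => ?_) (fun i => ?_) k
    · simp [evalVec_add]
    · simp only [Pi.add_apply, Fin.append_right, evalVec_add, add_dotProduct, add_div]
      rw [integral_add (U.integrable_cauchy hμ hpert hcauchy f i)
        (U.integrable_cauchy hμ hpert hcauchy g i)]
      ring
  map_smul' c f := by
    ext k
    refine Fin.addCases (fun j => ?_) (fun i => ?_) k
    · simp [evalVec_smul]
    · simp only [Pi.smul_apply, Fin.append_right, evalVec_smul, smul_dotProduct, smul_eq_mul,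
        mul_div_assoc, integral_const_mul, RingHom.id_apply]
      ring

theorem row_eq_rowMap (hμ : HasMoments μ) (hpert : U.PertWellDefined μ)
    (hcauchy : U.CauchyWellDefined μ) (B : ℕ → Fin q → ℂ[X]) (n : ℕ) :
    U.row μ B n = U.rowMap hμ hpert hcauchy (B n) := rfl

/-- Writing `r_i = (x - ρ_i) R⁻¹ g_i` turns the Cauchy integral of `f L` into minus the absolutely
continuous part of `Ĩ(f, g_i)`, and the term with `ξ_i` is minus its discrete part. -/
theorem rowMap_vecMul_L (hμ : HasMoments μ) (hpert : U.PertWellDefined μ)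
    (hcauchy : U.CauchyWellDefined μ) (f : Fin q → ℂ[X]) :
    U.rowMap hμ hpert hcauchy (Matrix.vecMul f U.L)
      = Fin.append (fun _ => 0) fun i => -U.pertForm hpert f (U.rquot i) := by
  ext k
  refine Fin.addCases (fun j => ?_) (fun i => ?_) k
  · simp only [rowMap, LinearMap.coe_mk, AddHom.coe_mk, Fin.append_left]
    rw [evalVec_vecMul, ← Matrix.dotProduct_mulVec, U.lvec_eigen, dotProduct_zero]
  · simp only [rowMap, LinearMap.coe_mk, AddHom.coe_mk, Fin.append_right]
    rw [pertForm_apply, pertPairing, neg_add, sub_eq_add_neg]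
    congr 1
    · rw [← integral_neg]
      refine integral_congr_ae ?_
      filter_upwards [hpert.1, U.ae_ne_rho hpert i] with x hx hx'
      have hu : IsUnit (evalMat U.R x).det := isUnit_iff_ne_zero.2 hx
      have h1 : U.rvec i = ((x : ℂ) - U.rho i) •
          Matrix.mulVec (evalMat U.R x)⁻¹ (evalVec (U.rquot i) x) := by
        rw [← Matrix.mulVec_smul, ← evalMat_R_mulVec_rvec, Matrix.mulVec_mulVec,
          Matrix.nonsing_inv_mul _ hu, Matrix.one_mulVec]
      have h0 : U.rho i - (x : ℂ) ≠ 0 := sub_ne_zero.2 hx'.symm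
      rw [h1, Matrix.mulVec_smul, dotProduct_smul, evalVec_vecMul, pertDensity,
        ← Matrix.dotProduct_mulVec, Matrix.mulVec_mulVec, Matrix.mulVec_mulVec, smul_eq_mul,
        div_eq_iff h0]
      ring
    · simp only [rcovec_dotProduct_rquot, mul_ite, mul_zero, Finset.sum_ite_eq', Finset.mem_univ,
        if_true]
      rw [evalVec_vecMul, Matrix.dotProduct_mulVec]

end UvarovData


/-! ### Expansions and orthogonality for both families of a Gauss–Borel factorization -/

section GaussBorel

variable {q p : ℕ} {I : (Fin q → ℂ[X]) →ₗ[ℂ] (Fin p → ℂ[X]) →ₗ[ℂ] ℂ}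
  {S Sbar : Matrix ℕ ℕ ℂ} {H : ℕ → ℂ}

namespace IsGaussBorel

theorem eq_sum_polyB (hM : IsGaussBorel (momentMatrix fun f g => I f g) S H Sbar) (hq : 0 < q)
    {N : ℕ} {f : Fin q → ℂ[X]} (hf : f ∈ stepSpace q N) :
    f = ∑ m ∈ Finset.range N, I f (polyA p H Sbar m) • polyB q S m :=
  eq_sum_of_biorthogonal hq (fun _ => one_ne_zero) (fun _ => polyB_sub_mem hM.lower)
    hM.biorthogonal hf

theorem apply_polyA_eq_zero (hM : IsGaussBorel (momentMatrix fun f g => I f g) S H Sbar)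
    (hq : 0 < q) {N : ℕ} {f : Fin q → ℂ[X]} (hf : f ∈ stepSpace q N) :
    I f (polyA p H Sbar N) = 0 :=
  eq_zero_of_biorthogonal hq (fun _ => one_ne_zero) (fun _ => polyB_sub_mem hM.lower)
    hM.biorthogonal hf

theorem flip_biorthogonal (hM : IsGaussBorel (momentMatrix fun f g => I f g) S H Sbar)
    (n m : ℕ) : I.flip (polyA p H Sbar n) (polyB q S m) = if n = m then 1 else 0 := by
  rw [LinearMap.flip_apply, hM.biorthogonal]
  simp only [eq_comm]

theorem eq_sum_polyA (hM : IsGaussBorel (momentMatrix fun f g => I f g) S H Sbar) (hp : 0 < p)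
    {N : ℕ} {g : Fin p → ℂ[X]} (hg : g ∈ stepSpace p N) :
    g = ∑ m ∈ Finset.range N, I (polyB q S m) g • polyA p H Sbar m :=
  eq_sum_of_biorthogonal hp (fun n => inv_ne_zero (hM.diag_ne_zero n))
    (fun _ => polyA_sub_mem hM.lower_bar) hM.flip_biorthogonal hg

theorem polyB_apply_eq_zero (hM : IsGaussBorel (momentMatrix fun f g => I f g) S H Sbar)
    (hp : 0 < p) {N : ℕ} {g : Fin p → ℂ[X]} (hg : g ∈ stepSpace p N) :
    I (polyB q S N) g = 0 :=
  eq_zero_of_biorthogonal hp (fun n => inv_ne_zero (hM.diag_ne_zero n))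
    (fun _ => polyA_sub_mem hM.lower_bar) hM.flip_biorthogonal hg

end IsGaussBorel

end GaussBorel

/-! ### The banded connection matrix -/

namespace UvarovData

variable {q p NL l NR r : ℕ} (U : UvarovData q p NL l NR r) {μ : MatrixMeasure q p}
  {S Sbar S' Sbar' : Matrix ℕ ℕ ℂ} {H H' : ℕ → ℂ}

theorem q_pos (U : UvarovData q p NL l NR r) : 0 < q := lt_of_le_of_lt (Nat.zero_le _) U.l_lt

theorem p_pos (U : UvarovData q p NL l NR r) : 0 < p := lt_of_le_of_lt (Nat.zero_le _) U.r_lt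

/-- The coefficient of `B_k` in the expansion of `B̃_m L`, which is also the coefficient of `Ã_m` in
the expansion of `R A_k`. -/
def connection (hμ : HasMoments μ) (S' Sbar : Matrix ℕ ℕ ℂ) (H : ℕ → ℂ) (m k : ℕ) : ℂ :=
  integralForm hμ (Matrix.vecMul (polyB q S' m) U.L) (polyA p H Sbar k)

variable (hμ : HasMoments μ) (hpert : U.PertWellDefined μ)
  (hM : IsGaussBorel (momentMatrix fun f g => integralForm hμ f g) S H Sbar)
  (hM' : IsGaussBorel (momentMatrix fun f g => U.pertForm hpert f g) S' H' Sbar')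

theorem vecMul_polyB_L_sub_mem (hS : IsLowerUnitriangular S') (m : ℕ) :
    Matrix.vecMul (polyB q S' m) U.L - (1 : ℂ) • monomialRow q (m + numEig NL q l)
      ∈ stepSpace q (m + numEig NL q l) :=
  U.isMonicShift_L.vecMul_sub_mem U.q_pos (polyB_sub_mem hS)

theorem vecMul_polyB_L_mem (hS : IsLowerUnitriangular S') {m N : ℕ}
    (h : m + numEig NL q l < N) : Matrix.vecMul (polyB q S' m) U.L ∈ stepSpace q N :=
  stepSpace_mono h (mem_stepSpace_of_sub_mem (U.vecMul_polyB_L_sub_mem hS m))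

theorem mulVec_R_polyA_mem (hS : IsLowerUnitriangular Sbar) {k N : ℕ}
    (h : k + numEig NR p r < N) : Matrix.mulVec U.R (polyA p H Sbar k) ∈ stepSpace p N := by
  have := mem_stepSpace_of_sub_mem
    (U.isMonicShift_R.vecMul_sub_mem U.p_pos (polyA_sub_mem (H := H) (n := k) hS))
  rw [Matrix.vecMul_transpose] at this
  exact stepSpace_mono h this

include hM hM' in
theorem vecMul_polyB_L_eq_sum {m N : ℕ} (h : m + numEig NL q l < N) :
    Matrix.vecMul (polyB q S' m) U.L
      = ∑ k ∈ Finset.range N, U.connection hμ S' Sbar H m k • polyB q S k :=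
  hM.eq_sum_polyB U.q_pos (U.vecMul_polyB_L_mem hM'.lower h)

include hM hM' in
theorem mulVec_R_polyA_eq_sum {k N : ℕ} (h : k + numEig NR p r < N) :
    Matrix.mulVec U.R (polyA p H Sbar k)
      = ∑ m ∈ Finset.range N, U.connection hμ S' Sbar H m k • polyA p H' Sbar' m := by
  simpa only [pertForm_mulVec U hpert hμ, connection] using
    hM'.eq_sum_polyA U.p_pos (U.mulVec_R_polyA_mem (H := H) hM.lower_bar h)

-- Upper edge of the band, from the degree of `B̃_m L` in the form of `μ`. The lower edge comes from
-- the degree of `R A_k` in the form of `μ̃`.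
include hM hM' in
theorem connection_eq_zero_of_lt {m k : ℕ} (h : m + numEig NL q l < k) :
    U.connection hμ S' Sbar H m k = 0 :=
  hM.apply_polyA_eq_zero U.q_pos (U.vecMul_polyB_L_mem hM'.lower h)

include hM hM' in
theorem connection_eq_zero_of_gt {m k : ℕ} (h : k + numEig NR p r < m) :
    U.connection hμ S' Sbar H m k = 0 := by
  rw [connection, ← pertForm_mulVec U hpert hμ]
  exact hM'.polyB_apply_eq_zero U.p_pos (U.mulVec_R_polyA_mem hM.lower_bar h)

-- `B̃_m L` and `B_{m+M^L}` have the same leading term, so their difference is orthogonal to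
-- `A_{m+M^L}`.
include hM hM' in
theorem connection_add_numEig (m : ℕ) :
    U.connection hμ S' Sbar H m (m + numEig NL q l) = 1 := by
  have h1 := sub_mem (U.vecMul_polyB_L_sub_mem hM'.lower m)
    (polyB_sub_mem (q := q) (n := m + numEig NL q l) hM.lower)
  rw [sub_sub_sub_cancel_right] at h1
  have h2 := hM.apply_polyA_eq_zero U.q_pos h1
  rw [map_sub, LinearMap.sub_apply, hM.biorthogonal, if_pos rfl] at h2
  exact sub_eq_zero.1 h2

/-! ### Type II polynomials -/

variable (hcauchy : U.CauchyWellDefined μ)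

include hM' in
theorem rowMap_vecMul_polyB_L {n : ℕ} (hn : numEig NR p r ≤ n) :
    U.rowMap hμ hpert hcauchy (Matrix.vecMul (polyB q S' n) U.L) = 0 := by
  rw [rowMap_vecMul_L]
  ext k
  refine Fin.addCases (fun j => ?_) (fun i => ?_) k
  · simp
  · simp [hM'.polyB_apply_eq_zero U.p_pos (stepSpace_mono hn (U.rquot_mem i))]

include hM hM' in
theorem vecMul_polyB_L_eq_sum_fin {n : ℕ} (hn : numEig NR p r ≤ n) :
    Matrix.vecMul (polyB q S' n) U.L = ∑ k : Fin (numEig NL q l + numEig NR p r + 1),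
      U.connection hμ S' Sbar H n (n - numEig NR p r + k)
        • polyB q S (n - numEig NR p r + k) := by
  rw [U.vecMul_polyB_L_eq_sum hμ hpert hM hM' (N := (n - numEig NR p r)
    + (numEig NL q l + numEig NR p r + 1)) (by omega), Finset.sum_range_add, Finset.sum_eq_zero,
    zero_add, Finset.sum_range]
  intro k hk
  have := Finset.mem_range.1 hk
  rw [U.connection_eq_zero_of_gt hμ hpert hM hM' (by omega), zero_smul]

theorem det_eq_of_last_row_eq_zero {M : ℕ} {T : Matrix (Fin (M + 1)) (Fin (M + 1)) ℂ}
    (h : ∀ j : Fin M, T (Fin.last M) j.castSucc = 0) :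
    T.det = T (Fin.last M) (Fin.last M) * (T.submatrix Fin.castSucc Fin.castSucc).det := by
  rw [Matrix.det_succ_row T (Fin.last M), Fin.sum_univ_castSucc]
  simp [h, Fin.succAbove_last, ← two_mul, pow_mul]

include hpert hcauchy hM hM' in
theorem detB_eq {n : ℕ} (hn : numEig NR p r ≤ n) (b : Fin q) (x : ℂ) :
    U.detB μ (polyB q S) n b x
      = U.tau μ (polyB q S) n * evalVec (Matrix.vecMul (polyB q S' n) U.L) x b := by
  set M := numEig NL q l + numEig NR p r with hMdef
  set N := n - numEig NR p r with hN
  set T : Matrix (Fin (M + 1)) (Fin (M + 1)) ℂ := Matrix.of fun k =>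
    (Fin.snoc (α := fun _ => ℂ) (U.row μ (polyB q S) (N + k))
      ((polyB q S (N + k) b).eval x) : Fin (M + 1) → ℂ) with hT
  have hdet : U.detB μ (polyB q S) n b x = T.det := rfl
  have hlast : U.connection hμ S' Sbar H n (N + (Fin.last M : Fin (M + 1))) = 1 := by
    rw [Fin.val_last, show N + M = n + numEig NL q l by omega]
    exact U.connection_add_numEig hμ hpert hM hM' n
  -- The band relation combines the bordered rows into one that vanishes except in its last entry.
  have hsum : (∑ k : Fin (M + 1), U.connection hμ S' Sbar H n (N + k) • T k)
      = (Fin.snoc (α := fun _ => ℂ) (0 : Fin M → ℂ)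
          (evalVec (Matrix.vecMul (polyB q S' n) U.L) x b) : Fin (M + 1) → ℂ) := by
    have h1 := U.vecMul_polyB_L_eq_sum_fin hμ hpert hM hM' hn
    have h2 := congrArg (U.rowMap hμ hpert hcauchy) h1
    rw [U.rowMap_vecMul_polyB_L hμ hpert hM' hcauchy hn, map_sum] at h2
    ext j
    refine Fin.lastCases ?_ (fun j => ?_) j
    · rw [Fin.snoc_last, h1, evalVec_sum]
      simp [hT, evalVec]
      rfl
    · rw [Fin.snoc_castSucc, h2]
      simp only [hT, Finset.sum_apply, Pi.smul_apply, Matrix.of_apply, Fin.snoc_castSucc, map_smul,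
        U.row_eq_rowMap hμ hpert hcauchy]
      rfl
  -- Replacing the last row by this combination multiplies the determinant by the last coefficient,
  -- which is `1`.
  have h3 := Matrix.det_updateRow_sum T (Fin.last M)
    fun k => U.connection hμ S' Sbar H n (N + k)
  rw [hlast, one_smul, hsum, det_eq_of_last_row_eq_zero] at h3
  · rw [hdet, ← h3, mul_comm]
    congr 1
    · rw [tau]
      congr 1
      ext i j
      rw [Matrix.submatrix_apply, Matrix.updateRow_ne (Fin.castSucc_lt_last i).ne]
      simp [hT, ← hN]
    · rw [Matrix.updateRow_self, Fin.snoc_last]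
  · intro j
    rw [Matrix.updateRow_self, Fin.snoc_castSucc, Pi.zero_apply]

/-! ### Type I polynomials -/

/-- The row with entries `0` and `r⃗_{i,a} / (x - ρ_i)`. -/
def poleRow (a : Fin p) (x : ℂ) : Fin (numEig NL q l + numEig NR p r) → ℂ :=
  Fin.append (fun _ => 0) fun i => U.rvec i a / (x - U.rho i)

theorem kernelRow_eq (A : ℕ → Fin p → ℂ[X]) (B : ℕ → Fin q → ℂ[X]) (N : ℕ) (a : Fin p) (x : ℂ) :
    U.kernelRow μ A B N a x = (∑ k ∈ Finset.range N,
      (A k a).eval x • U.rowMap hμ hpert hcauchy (B k)) + U.poleRow a x := by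
  have hK : ∀ (y : ℂ) (v : Fin q → ℂ), Matrix.mulVec (kernelK A B N x y) v a
      = ∑ k ∈ Finset.range N, (A k a).eval x * (evalVec (B k) y ⬝ᵥ v) := by
    intro y v
    simp only [Matrix.mulVec, dotProduct, kernelK, Matrix.of_apply, evalVec, Finset.sum_mul,
      Finset.mul_sum, mul_assoc]
    exact Finset.sum_comm
  ext k
  refine Fin.addCases (fun j => ?_) (fun i => ?_) k
  · simp only [kernelRow, poleRow, Fin.append_left, bbK, hK, Pi.add_apply, Finset.sum_apply,
      Pi.smul_apply, rowMap, LinearMap.coe_mk, AddHom.coe_mk, add_zero, smul_eq_mul]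
  · simp only [kernelRow, poleRow, Fin.append_right, bbKD, hK, Pi.add_apply, Finset.sum_apply,
      Pi.smul_apply, rowMap, LinearMap.coe_mk, AddHom.coe_mk, smul_eq_mul, kernelKD, cauchyD,
      Finset.sum_mul, ← Finset.sum_sub_distrib, mul_sub, mul_assoc]

theorem sum_smul_poleRow {x : ℂ} (hx : ∀ i, x ≠ U.rho i) (a : Fin p) :
    ∑ a', evalMat U.R x a a' • U.poleRow a' x
      = Fin.append (fun _ => 0) fun i => evalVec (U.rquot i) x a := by
  ext k
  refine Fin.addCases (fun j => ?_) (fun i => ?_) k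
  · simp [poleRow]
  · have h := congrFun (U.evalMat_R_mulVec_rvec i x) a
    have h0 : x - U.rho i ≠ 0 := sub_ne_zero.2 (hx i)
    simp only [Finset.sum_apply, Pi.smul_apply, poleRow, Fin.append_right, smul_eq_mul,
      ← mul_div_assoc, ← Finset.sum_div]
    rw [div_eq_iff h0, mul_comm]
    exact h

/-- The coefficient of `B_k` in `(∑_{m < n} Ã_m^{(a)}(x) B̃_m) L`. -/
def kernelCoeff (hμ : HasMoments μ) (S' Sbar Sbar' : Matrix ℕ ℕ ℂ) (H H' : ℕ → ℂ) (n : ℕ)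
    (a : Fin p) (x : ℂ) (k : ℕ) : ℂ :=
  ∑ m ∈ Finset.range n, (polyA p H' Sbar' m a).eval x * U.connection hμ S' Sbar H m k

-- Reproducing property: `∑_{m<n} Ã_m(x) Ĩ(B̃_m, g_i) = g_i(x)`, because `g_i` lies below step `M^R
-- ≤ n`.
include hM hM' in
theorem sum_kernelCoeff_smul {n : ℕ} (hn : numEig NR p r ≤ n) (a : Fin p) (x : ℂ) :
    ∑ k ∈ Finset.range (n + numEig NL q l), U.kernelCoeff hμ S' Sbar Sbar' H H' n a x k
        • U.rowMap hμ hpert hcauchy (polyB q S k)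
      = -Fin.append (fun _ => 0) fun i => evalVec (U.rquot i) x a := by
  have h1 : ∑ k ∈ Finset.range (n + numEig NL q l), U.kernelCoeff hμ S' Sbar Sbar' H H' n a x k
        • U.rowMap hμ hpert hcauchy (polyB q S k)
      = ∑ m ∈ Finset.range n, (polyA p H' Sbar' m a).eval x
        • U.rowMap hμ hpert hcauchy (Matrix.vecMul (polyB q S' m) U.L) := by
    simp only [kernelCoeff, Finset.sum_smul, mul_smul]
    rw [Finset.sum_comm]
    refine Finset.sum_congr rfl fun m hm => ?_
    have := Finset.mem_range.1 hm
    rw [U.vecMul_polyB_L_eq_sum hμ hpert hM hM' (N := n + numEig NL q l) (by omega), map_sum,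
      Finset.smul_sum]
    simp only [map_smul]
  rw [h1]
  ext k
  refine Fin.addCases (fun j => ?_) (fun i => ?_) k
  · simp [rowMap_vecMul_L]
  · have h2 := hM'.eq_sum_polyA U.p_pos (stepSpace_mono hn (U.rquot_mem i))
    have h3 := congrFun (congrArg (fun g => evalVec g x) h2) a
    simp only [evalVec_sum, evalVec_smul, Finset.sum_apply, Pi.smul_apply, smul_eq_mul] at h3
    simp only [rowMap_vecMul_L, Finset.sum_apply, Pi.smul_apply, Pi.neg_apply, Fin.append_right,
      smul_eq_mul, mul_neg, Finset.sum_neg_distrib, neg_inj]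
    rw [h3]
    exact Finset.sum_congr rfl fun m _ => mul_comm _ _

-- Column `k` of the connection matrix is supported on `m ≤ k + M^R < n`, so cutting the sum at `n`
-- loses nothing of the expansion of `R A_k`.
include hpert hM hM' in
theorem kernelCoeff_of_lt {n k : ℕ} (h : k + numEig NR p r < n) (a : Fin p) (x : ℂ) :
    U.kernelCoeff hμ S' Sbar Sbar' H H' n a x k
      = ∑ a', evalMat U.R x a a' * (polyA p H Sbar k a').eval x := by
  have h2 := congrFun (congrArg (fun g => evalVec g x)
    (U.mulVec_R_polyA_eq_sum hμ hpert hM hM' h)) a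
  simp only [evalVec_sum, evalVec_smul, evalVec_mulVec, Finset.sum_apply, Pi.smul_apply,
    smul_eq_mul] at h2
  rw [kernelCoeff]
  refine Eq.trans (Finset.sum_congr rfl fun m _ => mul_comm _ _) h2.symm

include hpert hM hM' in
theorem kernelCoeff_last {n : ℕ} (hn : 1 ≤ n) (a : Fin p) (x : ℂ) :
    U.kernelCoeff hμ S' Sbar Sbar' H H' n a x (n - 1 + numEig NL q l)
      = (polyA p H' Sbar' (n - 1) a).eval x := by
  rw [kernelCoeff, Finset.sum_eq_single (n - 1), U.connection_add_numEig hμ hpert hM hM', mul_one]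
  · intro m hm hne
    have := Finset.mem_range.1 hm
    rw [U.connection_eq_zero_of_lt hμ hpert hM hM' (by omega), mul_zero]
  · intro h
    exact absurd (Finset.mem_range.2 (by omega)) h

-- The expansion in `sum_kernelCoeff_smul` is split at `n - M^R`: below it the coefficients are `R
-- A_k`, and the remaining indices are those of the rows of `τ_n`.
include hM hM' in
theorem sum_smul_kernelRow {n : ℕ} (hn : numEig NR p r ≤ n) (a : Fin p) {x : ℂ}
    (hx : ∀ i, x ≠ U.rho i) :
    ∑ a', evalMat U.R x a a'
        • U.kernelRow μ (polyA p H Sbar) (polyB q S) (n - numEig NR p r) a' x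
      = -∑ k : Fin (numEig NL q l + numEig NR p r),
          U.kernelCoeff hμ S' Sbar Sbar' H H' n a x (n - numEig NR p r + k)
            • U.rowMap hμ hpert hcauchy (polyB q S (n - numEig NR p r + k)) := by
  have h1 := U.sum_kernelCoeff_smul hμ hpert hM hM' hcauchy hn a x
  rw [show n + numEig NL q l = n - numEig NR p r + (numEig NL q l + numEig NR p r) by omega,
    Finset.sum_range_add] at h1
  have h2 : ∑ k ∈ Finset.range (n - numEig NR p r), U.kernelCoeff hμ S' Sbar Sbar' H H' n a x k
        • U.rowMap hμ hpert hcauchy (polyB q S k)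
      = ∑ a', evalMat U.R x a a' • ∑ k ∈ Finset.range (n - numEig NR p r),
          (polyA p H Sbar k a').eval x • U.rowMap hμ hpert hcauchy (polyB q S k) := by
    simp only [Finset.smul_sum, smul_smul]
    rw [Finset.sum_comm]
    refine Finset.sum_congr rfl fun k hk => ?_
    have := Finset.mem_range.1 hk
    rw [U.kernelCoeff_of_lt hμ hpert hM hM' (by omega), Finset.sum_smul]
  simp only [U.kernelRow_eq hμ hpert hcauchy, smul_add, Finset.sum_add_distrib]
  rw [U.sum_smul_poleRow hx, ← h2, ← neg_eq_iff_eq_neg.2 h1, ← Finset.sum_range (f := fun k =>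
    U.kernelCoeff hμ S' Sbar Sbar' H H' n a x (n - numEig NR p r + k)
      • U.rowMap hμ hpert hcauchy (polyB q S (n - numEig NR p r + k)))]
  abel

include hpert hcauchy hM hM' in
theorem sum_mul_detA {n : ℕ} (hn : numEig NR p r ≤ n) (h1 : 1 ≤ n)
    (hpos : 0 < numEig NL q l + numEig NR p r) (a : Fin p) {x : ℂ} (hx : ∀ i, x ≠ U.rho i) :
    ∑ a', evalMat U.R x a a' * U.detA μ (polyA p H Sbar) (polyB q S) n a' x
      = -((polyA p H' Sbar' (n - 1) a).eval x * U.tau μ (polyB q S) n) := by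
  set M := numEig NL q l + numEig NR p r with hMdef
  set N := n - numEig NR p r with hN
  set T : Matrix (Fin M) (Fin M) ℂ := Matrix.of fun k => U.row μ (polyB q S) (N + k) with hT
  set e : Fin M := ⟨M - 1, by omega⟩ with he
  -- Cramer's map of the transpose expresses the replacement of row `e`, the last one, as a linear
  -- function of the new row, so the sum over `a'` can be moved inside.
  have hdet : ∀ a', U.detA μ (polyA p H Sbar) (polyB q S) n a' x
      = Matrix.cramer T.transpose (U.kernelRow μ (polyA p H Sbar) (polyB q S) N a' x) e := by
    intro a'
    rw [Matrix.cramer_transpose_apply, detA]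
    congr 1
    ext k j
    by_cases hk : (k : ℕ) + 1 < M
    · rw [Matrix.updateRow_ne (by rintro rfl; simp only [he] at hk; omega), Matrix.of_apply,
        if_pos hk]
      rfl
    · have hke : k = e := Fin.ext (by have := k.2; simp only [he]; omega)
      rw [Matrix.of_apply, if_neg hk, hke, Matrix.updateRow_self]
  have h2 : ∑ a', evalMat U.R x a a' * U.detA μ (polyA p H Sbar) (polyB q S) n a' x
      = Matrix.cramer T.transpose (∑ a', evalMat U.R x a a'
        • U.kernelRow μ (polyA p H Sbar) (polyB q S) N a' x) e := by
    simp only [hdet, map_sum, map_smul, Finset.sum_apply, Pi.smul_apply, smul_eq_mul]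
  rw [h2, U.sum_smul_kernelRow hμ hpert hM hM' hcauchy hn a hx, map_neg, Pi.neg_apply,
    Matrix.cramer_transpose_apply]
  congr 1
  refine (Matrix.det_updateRow_sum T e fun k =>
    U.kernelCoeff hμ S' Sbar Sbar' H H' n a x (N + k)).trans ?_
  rw [show N + (e : ℕ) = n - 1 + numEig NL q l by simp only [he]; omega,
    U.kernelCoeff_last hμ hpert hM hM' h1, smul_eq_mul]
  rfl

end UvarovData

end MixedMOP

end

/-! ### The determinantal formulas -/

theorem mainTheorem1 {q p NL l NR r : ℕ}
    (μ : MixedMOP.MatrixMeasure q p) (hμ : MixedMOP.HasMoments μ)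
    (U : MixedMOP.UvarovData q p NL l NR r)
    (hpert : U.PertWellDefined μ) (hcauchy : U.CauchyWellDefined μ)
    (S Sbar : Matrix ℕ ℕ ℂ) (H : ℕ → ℂ)
    (hM : MixedMOP.IsGaussBorel (MixedMOP.momentMatrix (MixedMOP.pairing μ)) S H Sbar)
    (S' Sbar' : Matrix ℕ ℕ ℂ) (H' : ℕ → ℂ)
    (hM' : MixedMOP.IsGaussBorel (MixedMOP.momentMatrix (U.pertPairing μ)) S' H' Sbar')
    (n : ℕ) (hn : MixedMOP.numEig NR p r ≤ n)
    (hτ : U.tau μ (MixedMOP.polyB q S) n ≠ 0) :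
    (1 ≤ n → 0 < MixedMOP.numEig NL q l + MixedMOP.numEig NR p r →
      ∀ (a : Fin p) (x : ℂ), (∀ i, x ≠ U.rho i) →
        (MixedMOP.polyA p H' Sbar' (n - 1) a).eval x =
          -(1 / U.tau μ (MixedMOP.polyB q S) n) *
            ∑ a' : Fin p, MixedMOP.evalMat U.R x a a' *
              U.detA μ (MixedMOP.polyA p H Sbar) (MixedMOP.polyB q S) n a' x) ∧
    (∀ (b : Fin q) (x : ℂ), (MixedMOP.evalMat U.L x).det ≠ 0 →
        (MixedMOP.polyB q S' n b).eval x =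
          (1 / U.tau μ (MixedMOP.polyB q S) n) *
            ∑ b' : Fin q, U.detB μ (MixedMOP.polyB q S) n b' x *
              (MixedMOP.evalMat U.L x)⁻¹ b' b) := by
  have hM₁ : MixedMOP.IsGaussBorel (MixedMOP.momentMatrix
      fun f g => MixedMOP.integralForm hμ f g) S H Sbar := hM
  have hM₂ : MixedMOP.IsGaussBorel (MixedMOP.momentMatrix
      fun f g => U.pertForm hpert f g) S' H' Sbar' := by
    simpa only [U.pertForm_apply] using hM'
  refine ⟨fun h1 hpos a x hx => ?_, fun b x hx => ?_⟩
  · rw [U.sum_mul_detA hμ hpert hM₁ hM₂ hcauchy hn h1 hpos a hx]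
    field_simp
  · have hu : IsUnit (MixedMOP.evalMat U.L x).det := isUnit_iff_ne_zero.2 hx
    -- `detB_eq` yields `B̃_n L`; the factor `L(x)` is removed on the right.
    have h2 : Matrix.vecMul (MixedMOP.evalVec (Matrix.vecMul (MixedMOP.polyB q S' n) U.L) x)
        (MixedMOP.evalMat U.L x)⁻¹ = MixedMOP.evalVec (MixedMOP.polyB q S' n) x := by
      rw [MixedMOP.evalVec_vecMul, Matrix.vecMul_vecMul, Matrix.mul_nonsing_inv _ hu,
        Matrix.vecMul_one]
    simp only [U.detB_eq hμ hpert hM₁ hM₂ hcauchy hn, mul_assoc, ← Finset.mul_sum]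
    rw [← mul_assoc, one_div, inv_mul_cancel₀ hτ, one_mul]
    exact (congrFun h2 b).symm
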